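/- For a measurable $f:\mathbb{R}\to\mathbb{C}$ put $$\|f\|_{B^2}=\Big(\limsup_{l\to\infty}\frac1{2l}\int_{-l}^{l}|f(t)|^2\,dt\Big)^{1/2}.$$ Let $B^2(\mathbb{R},\mathbb{C})$ be the space of measurable functions $f:\mathbb{R}\to\mathbb{C}$ that are limits, in the seminorm $\|\cdot\|_{B^2}$, of trigonometric polynomials $a_1e^{i\lambda_1t}+\dots+a_ne^{i\lambda_nt}$ ($\lambda_j\in\mathbb{R}$, $a_j\in\mathbb{C}$), two functions $f_1,f_2$ being identified when $\|f_1-f_2\|_{B^2}=0$; it is a normed space with norm $\|\cdot\|_{B^2}$. For $f\in B^2(\mathbb{R},\mathbb{C})$ and $\tau\in\mathbb{R}$ let $f_\tau(t)=f(t+\tau)$, and for $\lambda\in\mathbb{R}$ let $$a(f,\lambda)=\lim_{l\to\infty}\frac1{2l}\int_{-l}^{l}f(t)e^{-i\lambda t}\,dt$$ be the Fourier coefficients of $f$. For a finite or countably infinite set $\Lambda=\{\lambda_1,\lambda_2,\dots\}$ of distinct real numbers (with a fixed enumeration), let $\mathcal{F}_{B^2,\Lambda}$ be the set of those $f\in B^2(\mathbb{R},\mathbb{C})$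 with $a(f,\lambda)=0$ for all $\lambda\notin\Lambda$. Two elements $f,g\in\mathcal{F}_{B^2,\Lambda}$ are called equivalent if for each integer $n\ge 1$ with $n\le\sharp\Lambda$ there is a $\mathbb{Q}$-linear map $\psi_n:V_n\to\mathbb{R}$, where $V_n$ is the $\mathbb{Q}$-vector space generated by $\lambda_1,\dots,\lambda_n$, such that $$a(g,\lambda_j)=a(f,\lambda_j)\,e^{i\psi_n(\lambda_j)},\qquad j=1,\dots,n.$$ **Corollary.** Let $f\in B^2(\mathbb{R},\mathbb{C})$. Then the closure in $B^2(\mathbb{R},\mathbb{C})$ of the set of translates $\{f_\tau:\tau\in\mathbb{R}\}$ is compact. Moreover $f\in\mathcal{F}_{B^2,\Lambda}$ for some $\Lambda$ as above, and for every such $\Lambda$ with $f\in\mathcal{F}_{B^2,\Lambda}$ the closure of the set of translates of $f$ is equal to the equivalence class of $f$ in $\mathcal{F}_{B^2,\Lambda}$. Consequently, for every sequence $(\tau_n)$ of real numbers, the sequence $(f_{\tau_n})$ has a subsequence that converges in $B^2(\mathbb{R},\mathbb{C})$ to a function in the equivalence class of $f$. -/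

import Mathlib

open MeasureTheory Filter Topology
open scoped ENNReal

noncomputable section

namespace Besicovitch2

/-- The quadratic mean of `f` over `[-l, l]`, that is `(2l)⁻¹ ∫_{-l}^{l} |f(t)|² dt`,
as an extended nonnegative number. -/
def sqMean (f : ℝ → ℂ) (l : ℝ) : ℝ≥0∞ :=
  (ENNReal.ofReal (2 * l))⁻¹ * ∫⁻ t in Set.Icc (-l) l, ‖f t‖ₑ ^ (2 : ℝ)

/-- The Besicovitch seminorm `(limsup_{l → ∞} (2l)⁻¹ ∫_{-l}^{l} |f(t)|² dt)^{1/2}`. -/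
def seminorm (f : ℝ → ℂ) : ℝ≥0∞ :=
  (limsup (fun l : ℝ => sqMean f l) atTop) ^ (1 / 2 : ℝ)

/-- The trigonometric polynomials `a₁ e^{i λ₁ t} + ... + aₙ e^{i λₙ t}`, with arbitrary real
exponents and complex coefficients. -/
def trigPoly : Submodule ℂ (ℝ → ℂ) :=
  Submodule.span ℂ (Set.range fun (lam : ℝ) (t : ℝ) => Complex.exp (Complex.I * lam * t))

/-- `f : ℝ → ℂ` is a Besicovitch almost periodic function of order two: it is (Lebesgue) measurable
and a limit of trigonometric polynomials in the Besicovitch seminorm. -/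
def MemB2 (f : ℝ → ℂ) : Prop :=
  AEStronglyMeasurable f volume ∧
    ∀ ε : ℝ≥0∞, 0 < ε → ∃ P ∈ trigPoly, seminorm (f - P) < ε

/-! ### Elementary facts about the seminorm -/

/-- Normalized Lebesgue measure on `[-l, l]`. -/
def avg (l : ℝ) : Measure ℝ := (ENNReal.ofReal (2 * l))⁻¹ • volume.restrict (Set.Icc (-l) l)

theorem sqMean_eq (f : ℝ → ℂ) (l : ℝ) : sqMean f l = ∫⁻ t, ‖f t‖ₑ ^ (2 : ℝ) ∂(avg l) := by
  simp [sqMean, avg, lintegral_smul_measure]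

theorem sqMean_rpow (f : ℝ → ℂ) (l : ℝ) : sqMean f l ^ (1 / 2 : ℝ) = eLpNorm f 2 (avg l) := by
  rw [sqMean_eq, eLpNorm_eq_lintegral_rpow_enorm_toReal (by simp) (by simp)]
  simp

theorem seminorm_eq (f : ℝ → ℂ) :
    seminorm f = limsup (fun l : ℝ => eLpNorm f 2 (avg l)) atTop := by
  have h := OrderIso.limsup_apply (f := (atTop : Filter ℝ)) (u := fun l => sqMean f l)
    (ENNReal.orderIsoRpow (1 / 2) (by norm_num))
  simp only [ENNReal.orderIsoRpow_apply] at h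
  rw [seminorm, h]
  simp only [sqMean_rpow]

theorem avg_ac (l : ℝ) : avg l ≪ volume :=
  (Measure.smul_absolutelyContinuous).trans Measure.restrict_le_self.absolutelyContinuous

theorem isProbabilityMeasure_avg {l : ℝ} (hl : 0 < l) : IsProbabilityMeasure (avg l) := by
  constructor
  have h : l - -l = 2 * l := by ring
  simp only [avg, Measure.smul_apply, Measure.restrict_apply_univ, Real.volume_Icc, h, smul_eq_mul]
  exact ENNReal.inv_mul_cancel (by simpa using hl) ENNReal.ofReal_ne_top

theorem limsup_add_le_ennreal (u v : ℝ → ℝ≥0∞) :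
    limsup (fun l => u l + v l) atTop ≤ limsup u atTop + limsup v atTop := by
  refine ENNReal.le_of_forall_pos_le_add fun ε hε hlt => ?_
  rw [ENNReal.add_lt_top] at hlt
  have hε' : (ε / 2 : ℝ≥0∞) ≠ 0 := by simpa using hε.ne'
  have hu := eventually_lt_of_limsup_lt (ENNReal.lt_add_right hlt.1.ne hε')
  have hv := eventually_lt_of_limsup_lt (ENNReal.lt_add_right hlt.2.ne hε')
  refine limsup_le_of_le (by isBoundedDefault) ?_
  filter_upwards [hu, hv] with l h1 h2
  refine (add_le_add h1.le h2.le).trans_eq ?_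
  rw [add_add_add_comm, ENNReal.add_halves]

theorem seminorm_add_le {f g : ℝ → ℂ} (hf : AEStronglyMeasurable f volume)
    (hg : AEStronglyMeasurable g volume) : seminorm (f + g) ≤ seminorm f + seminorm g := by
  simp only [seminorm_eq]
  refine le_trans (limsup_le_limsup (Eventually.of_forall fun l => ?_))
    (limsup_add_le_ennreal _ _)
  exact eLpNorm_add_le (hf.mono_ac (avg_ac l)) (hg.mono_ac (avg_ac l)) (by norm_num)

theorem seminorm_zero : seminorm 0 = 0 := by
  simp [seminorm_eq]

theorem seminorm_neg (f : ℝ → ℂ) : seminorm (-f) = seminorm f := by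
  simp only [seminorm_eq, eLpNorm_neg]

theorem seminorm_const_smul (c : ℂ) (f : ℝ → ℂ) :
    seminorm (c • f) = ‖c‖ₑ * seminorm f := by
  simp only [seminorm_eq, eLpNorm_const_smul]
  exact ENNReal.limsup_const_mul_of_ne_top (by simp)

theorem continuous_of_mem_trigPoly {P : ℝ → ℂ} (hP : P ∈ trigPoly) : Continuous P := by
  induction hP using Submodule.span_induction with
  | mem x hx =>
    obtain ⟨lam, rfl⟩ := hx
    fun_prop
  | zero => exact continuous_zero
  | add x y _ _ hx hy => exact hx.add hy
  | smul a x _ hx => exact hx.const_smul a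

theorem seminorm_lt_top_of_mem_trigPoly {P : ℝ → ℂ} (hP : P ∈ trigPoly) : seminorm P < ∞ := by
  induction hP using Submodule.span_induction with
  | mem x hx =>
    obtain ⟨lam, rfl⟩ := hx
    rw [seminorm_eq]
    refine lt_of_le_of_lt (b := 1) ?_ (by simp)
    refine limsup_le_of_le (by isBoundedDefault) ?_
    filter_upwards [eventually_gt_atTop 0] with l hl
    have := isProbabilityMeasure_avg hl
    refine (eLpNorm_le_of_ae_bound (C := 1) (Eventually.of_forall fun t => ?_)).trans (by simp)
    have : Complex.I * lam * t = ((lam * t : ℝ) : ℂ) * Complex.I := by push_cast; ring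
    rw [this, Complex.norm_exp_ofReal_mul_I]
  | zero => simp [seminorm_zero]
  | add x y hx' hy' hx hy =>
    exact lt_of_le_of_lt (seminorm_add_le (continuous_of_mem_trigPoly hx').aestronglyMeasurable
      (continuous_of_mem_trigPoly hy').aestronglyMeasurable) (ENNReal.add_lt_top.2 ⟨hx, hy⟩)
  | smul a x _ hx =>
    rw [seminorm_const_smul]
    exact ENNReal.mul_lt_top (by simp) hx

theorem MemB2.seminorm_lt_top {f : ℝ → ℂ} (hf : MemB2 f) : seminorm f < ∞ := by
  obtain ⟨P, hP, h⟩ := hf.2 1 (by simp)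
  have hc := (continuous_of_mem_trigPoly hP).aestronglyMeasurable (μ := volume)
  have := seminorm_add_le (hf.1.sub hc) hc
  rw [sub_add_cancel] at this
  exact this.trans_lt
    (ENNReal.add_lt_top.2 ⟨h.trans (by simp), seminorm_lt_top_of_mem_trigPoly hP⟩)

/-! ### The space `B²(ℝ, ℂ)` -/

/-- The additive group of Besicovitch almost periodic functions of order two. -/
def funAddSubgroup : AddSubgroup (ℝ → ℂ) where
  carrier := {f | MemB2 f}
  zero_mem' := ⟨aestronglyMeasurable_zero, fun ε hε => ⟨0, zero_mem _, by
    simpa [seminorm_zero] using hε⟩⟩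
  add_mem' := by
    rintro f g ⟨hf, hf'⟩ ⟨hg, hg'⟩
    refine ⟨hf.add hg, fun ε hε => ?_⟩
    obtain ⟨P, hP, h1⟩ := hf' (ε / 2) (ENNReal.half_pos hε.ne')
    obtain ⟨Q, hQ, h2⟩ := hg' (ε / 2) (ENNReal.half_pos hε.ne')
    refine ⟨P + Q, add_mem hP hQ, ?_⟩
    rw [add_sub_add_comm, ← ENNReal.add_halves ε]
    exact (seminorm_add_le
      (hf.sub (continuous_of_mem_trigPoly hP).aestronglyMeasurable)
      (hg.sub (continuous_of_mem_trigPoly hQ).aestronglyMeasurable)).trans_lt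
      (ENNReal.add_lt_add h1 h2)
  neg_mem' := by
    rintro f ⟨hf, hf'⟩
    refine ⟨hf.neg, fun ε hε => ?_⟩
    obtain ⟨P, hP, h⟩ := hf' ε hε
    refine ⟨-P, neg_mem hP, ?_⟩
    rwa [neg_sub_neg, ← neg_sub, seminorm_neg]

/-- The Besicovitch almost periodic functions of order two, as a type of its own, so that it
carries the Besicovitch seminorm and not the topology of pointwise convergence. -/
def B2Fun : Type := funAddSubgroup

namespace B2Fun

instance : AddCommGroup B2Fun := inferInstanceAs (AddCommGroup funAddSubgroup)

/-- The underlying function. -/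
def toFun (f : B2Fun) : ℝ → ℂ := f.1

theorem mem (f : B2Fun) : MemB2 f.toFun := f.2

@[simp] theorem toFun_zero : (0 : B2Fun).toFun = 0 := rfl

@[simp] theorem toFun_add (f g : B2Fun) : (f + g).toFun = f.toFun + g.toFun := rfl

@[simp] theorem toFun_neg (f : B2Fun) : (-f).toFun = -f.toFun := rfl

@[simp] theorem toFun_sub (f g : B2Fun) : (f - g).toFun = f.toFun - g.toFun := rfl

/-- The Besicovitch seminorm on `B2Fun`. -/
def addGroupSeminorm : AddGroupSeminorm B2Fun where
  toFun f := (seminorm f.toFun).toReal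
  map_zero' := by simp [seminorm_zero]
  add_le' f g := by
    rw [← ENNReal.toReal_add f.mem.seminorm_lt_top.ne g.mem.seminorm_lt_top.ne]
    refine ENNReal.toReal_mono ?_ (seminorm_add_le f.mem.1 g.mem.1)
    exact ENNReal.add_ne_top.2 ⟨f.mem.seminorm_lt_top.ne, g.mem.seminorm_lt_top.ne⟩
  neg' f := by simp [seminorm_neg]

instance : SeminormedAddCommGroup B2Fun := addGroupSeminorm.toSeminormedAddCommGroup

theorem norm_def (f : B2Fun) : ‖f‖ = (seminorm f.toFun).toReal := rfl

theorem inseparable_iff (f g : B2Fun) :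
    Inseparable f g ↔ seminorm (f.toFun - g.toFun) = 0 := by
  rw [Metric.inseparable_iff, dist_eq_norm, norm_def, toFun_sub,
    ENNReal.toReal_eq_zero_iff, or_iff_left]
  exact (f - g).mem.seminorm_lt_top.ne

end B2Fun

/-- The normed space `B²(ℝ, ℂ)`: Besicovitch almost periodic functions of order two, two functions
being identified when their difference has Besicovitch seminorm zero. -/
abbrev B2 : Type := SeparationQuotient B2Fun

/-! ### Translates -/

theorem sqMean_translate_le (f : ℝ → ℂ) (τ : ℝ) {l : ℝ} (hl : 0 < l) :
    sqMean (fun t => f (t + τ)) l ≤ ENNReal.ofReal ((l + |τ|) / l) * sqMean f (l + |τ|) := by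
  have hτ := abs_nonneg τ
  have h1 : ∫⁻ t in Set.Icc (-l) l, ‖f (t + τ)‖ₑ ^ (2 : ℝ)
      ≤ ∫⁻ t in Set.Icc (-(l + |τ|)) (l + |τ|), ‖f t‖ₑ ^ (2 : ℝ) := by
    have hpre : Set.Icc (-l) l = (fun t => t + τ) ⁻¹' (Set.Icc (-l + τ) (l + τ)) := by simp
    rw [hpre, (measurePreserving_add_right volume τ).setLIntegral_comp_preimage_emb
      (measurableEmbedding_addRight τ) (fun t => ‖f t‖ₑ ^ (2 : ℝ))]
    refine lintegral_mono_set (Set.Icc_subset_Icc ?_ ?_)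
    · linarith [neg_abs_le τ]
    · linarith [le_abs_self τ]
  have h2 : (ENNReal.ofReal (2 * l))⁻¹
      = ENNReal.ofReal ((l + |τ|) / l) * (ENNReal.ofReal (2 * (l + |τ|)))⁻¹ := by
    rw [← ENNReal.ofReal_inv_of_pos (by positivity), ← ENNReal.ofReal_inv_of_pos (by positivity),
      ← ENNReal.ofReal_mul (by positivity)]
    congr 1
    field_simp
  unfold sqMean
  rw [← mul_assoc, ← h2]
  gcongr

theorem seminorm_translate_le (f : ℝ → ℂ) (τ : ℝ) :
    seminorm (fun t => f (t + τ)) ≤ seminorm f := by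
  refine ENNReal.rpow_le_rpow ?_ (by norm_num)
  have h1 : Tendsto (fun l : ℝ => ENNReal.ofReal ((l + |τ|) / l)) atTop (𝓝 1) := by
    rw [← ENNReal.ofReal_one]
    refine ENNReal.tendsto_ofReal ?_
    have : Tendsto (fun l : ℝ => 1 + |τ| / l) atTop (𝓝 (1 + 0)) :=
      tendsto_const_nhds.add (tendsto_const_nhds.div_atTop tendsto_id)
    rw [add_zero] at this
    refine this.congr' ?_
    filter_upwards [eventually_gt_atTop 0] with l hl
    field_simp
  calc limsup (fun l : ℝ => sqMean (fun t => f (t + τ)) l) atTop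
      ≤ limsup ((fun l : ℝ => ENNReal.ofReal ((l + |τ|) / l)) *
          fun l => sqMean f (l + |τ|)) atTop := by
        refine limsup_le_limsup ?_
        filter_upwards [eventually_gt_atTop 0] with l hl
        exact sqMean_translate_le f τ hl
    _ ≤ limsup (fun l : ℝ => ENNReal.ofReal ((l + |τ|) / l)) atTop *
          limsup (fun l => sqMean f (l + |τ|)) atTop :=
        ENNReal.limsup_mul_le' (by simp [h1.limsup_eq]) (by simp [h1.limsup_eq])
    _ = limsup (fun l => sqMean f l) atTop := by
        rw [h1.limsup_eq, one_mul]
        have h2 := limsup_comp (sqMean f) (fun l : ℝ => l + |τ|) atTop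
        rw [map_add_atTop_eq] at h2
        exact h2

theorem translate_mem_trigPoly {P : ℝ → ℂ} (hP : P ∈ trigPoly) (τ : ℝ) :
    (fun t => P (t + τ)) ∈ trigPoly := by
  induction hP using Submodule.span_induction with
  | mem x hx =>
    obtain ⟨lam, rfl⟩ := hx
    have : (fun t : ℝ => Complex.exp (Complex.I * lam * ((t + τ : ℝ) : ℂ)))
        = Complex.exp (Complex.I * lam * τ) •
          fun t : ℝ => Complex.exp (Complex.I * lam * t) := by
      funext t
      simp only [Pi.smul_apply, smul_eq_mul, ← Complex.exp_add]
      congr 1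
      push_cast
      ring
    simp only [this]
    exact Submodule.smul_mem _ _ (Submodule.subset_span ⟨lam, rfl⟩)
  | zero => exact zero_mem _
  | add x y _ _ hx hy => exact add_mem hx hy
  | smul a x _ hx => exact Submodule.smul_mem _ a hx

theorem MemB2.translate {f : ℝ → ℂ} (hf : MemB2 f) (τ : ℝ) : MemB2 fun t => f (t + τ) := by
  refine ⟨hf.1.comp_measurePreserving (measurePreserving_add_right volume τ), fun ε hε => ?_⟩
  obtain ⟨P, hP, h⟩ := hf.2 ε hε
  exact ⟨_, translate_mem_trigPoly hP τ, (seminorm_translate_le (f - P) τ).trans_lt h⟩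

/-- The translate `t ↦ f(t + τ)` of a function `f`. -/
def B2Fun.translate (τ : ℝ) (f : B2Fun) : B2Fun := ⟨fun t => f.toFun (t + τ), f.mem.translate τ⟩

/-- The translate `t ↦ f(t + τ)` of an element `f` of `B²(ℝ, ℂ)`. -/
def B2.translate (τ : ℝ) : B2 → B2 :=
  SeparationQuotient.lift (fun f => SeparationQuotient.mk (f.translate τ)) fun f g h => by
    rw [SeparationQuotient.mk_eq_mk]
    rw [B2Fun.inseparable_iff] at h ⊢
    exact le_antisymm ((seminorm_translate_le (f.toFun - g.toFun) τ).trans_eq h) bot_le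

/-- The set of translates `{t ↦ f(t + τ) : τ ∈ ℝ}` of `f`, as a subset of `B²(ℝ, ℂ)`. -/
def B2.translates (f : B2) : Set B2 := Set.range fun τ : ℝ => B2.translate τ f

/-! ### Fourier coefficients -/

/-- `(2l)⁻¹ ∫_{-l}^{l} f(t) e^{-iλt} dt`. -/
def coeffMean (f : ℝ → ℂ) (lam l : ℝ) : ℂ :=
  ((2 * l : ℝ) : ℂ)⁻¹ * ∫ t in (-l)..l, f t * Complex.exp (-(Complex.I * lam * t))

/-- The Fourier coefficient `a(f, λ) = M(f(t) e^{-iλt})` of a function `f`, where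
`M(g) = lim_{l → ∞} (2l)⁻¹ ∫_{-l}^{l} g(t) dt` is the mean value. -/
def fourierCoeffFun (f : ℝ → ℂ) (lam : ℝ) : ℂ :=
  limUnder atTop fun l : ℝ => coeffMean f lam l

theorem norm_exp_neg (lam t : ℝ) : ‖Complex.exp (-(Complex.I * lam * t))‖ = 1 := by
  have : -(Complex.I * lam * t) = ((-(lam * t) : ℝ) : ℂ) * Complex.I := by push_cast; ring
  rw [this, Complex.norm_exp_ofReal_mul_I]

theorem MemB2.eventually_intervalIntegrable {f : ℝ → ℂ} (hf : MemB2 f) (lam : ℝ) :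
    ∀ᶠ l : ℝ in atTop, IntervalIntegrable
      (fun t => f t * Complex.exp (-(Complex.I * lam * t))) volume (-l) l := by
  have h := hf.seminorm_lt_top
  rw [seminorm_eq] at h
  filter_upwards [eventually_lt_of_limsup_lt h, eventually_gt_atTop 0] with l h1 hl
  have := isProbabilityMeasure_avg hl
  have h2 : MemLp f 2 (avg l) := ⟨hf.1.mono_ac (avg_ac l), h1⟩
  have h3 : Integrable f (avg l) := h2.integrable (by norm_num)
  have h4 : IntegrableOn f (Set.Icc (-l) l) volume := by
    refine (integrable_smul_measure (c := (ENNReal.ofReal (2 * l))⁻¹) ?_ ?_).1 h3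
    · exact ENNReal.inv_ne_zero.2 ENNReal.ofReal_ne_top
    · simpa using hl
  rw [intervalIntegrable_iff_integrableOn_Icc_of_le (by linarith)]
  refine Integrable.mul_bdd (c := 1) h4 ?_ (Eventually.of_forall fun t => (norm_exp_neg lam t).le)
  exact Continuous.aestronglyMeasurable (by fun_prop)

theorem enorm_coeffMean_le {f : ℝ → ℂ} (hf : AEStronglyMeasurable f volume) (lam : ℝ) {l : ℝ}
    (hl : 0 < l) : ‖coeffMean f lam l‖ₑ ≤ eLpNorm f 2 (avg l) := by
  have := isProbabilityMeasure_avg hl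
  refine le_trans ?_ (eLpNorm_le_eLpNorm_of_exponent_le (p := 1) (by norm_num)
    (hf.mono_ac (avg_ac l)))
  rw [eLpNorm_one_eq_lintegral_enorm, avg, lintegral_smul_measure, coeffMean, enorm_mul,
    smul_eq_mul]
  have h1 : ‖((2 * l : ℝ) : ℂ)⁻¹‖ₑ = (ENNReal.ofReal (2 * l))⁻¹ := by
    rw [enorm_inv (by simpa using hl.ne'), ← ofReal_norm, Complex.norm_real,
      Real.norm_of_nonneg (by positivity)]
  rw [h1]
  gcongr
  rw [intervalIntegral.integral_of_le (by linarith)]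
  refine (enorm_integral_le_lintegral_enorm _).trans ?_
  refine (lintegral_mono_set Set.Ioc_subset_Icc_self).trans (lintegral_mono fun t => ?_)
  rw [enorm_mul, ← ofReal_norm (Complex.exp _), norm_exp_neg]
  simp

theorem tendsto_coeffMean_sub {f g : ℝ → ℂ} (hf : MemB2 f) (hg : MemB2 g)
    (h : seminorm (f - g) = 0) (lam : ℝ) :
    Tendsto (fun l => coeffMean f lam l - coeffMean g lam l) atTop (𝓝 0) := by
  rw [seminorm_eq] at h
  have h0 : Tendsto (fun l => eLpNorm (f - g) 2 (avg l)) atTop (𝓝 0) :=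
    tendsto_of_le_liminf_of_limsup_le bot_le h.le
  rw [tendsto_zero_iff_enorm_tendsto_zero]
  refine tendsto_of_tendsto_of_tendsto_of_le_of_le' tendsto_const_nhds h0
    (Eventually.of_forall fun _ => bot_le) ?_
  filter_upwards [hf.eventually_intervalIntegrable lam, hg.eventually_intervalIntegrable lam,
    eventually_gt_atTop 0] with l h1 h2 hl
  refine le_of_eq_of_le ?_ (enorm_coeffMean_le (hf.1.sub hg.1) lam hl)
  congr 1
  simp only [coeffMean, ← mul_sub, ← intervalIntegral.integral_sub h1 h2, Pi.sub_apply, sub_mul]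

theorem fourierCoeffFun_congr {f g : ℝ → ℂ} (hf : MemB2 f) (hg : MemB2 g)
    (h : seminorm (f - g) = 0) : fourierCoeffFun f = fourierCoeffFun g := by
  funext lam
  have key : ∀ x, map (fun l => coeffMean f lam l) atTop ≤ 𝓝 x ↔
      map (fun l => coeffMean g lam l) atTop ≤ 𝓝 x := by
    intro x
    have h1 := tendsto_coeffMean_sub hf hg h lam
    constructor
    · intro h2
      have h3 := Tendsto.sub (f := fun l => coeffMean f lam l) h2 h1
      simpa [Tendsto] using h3
    · intro h2
      have h3 := Tendsto.add (f := fun l => coeffMean g lam l) h2 h1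
      simpa [Tendsto] using h3
  simp only [fourierCoeffFun, limUnder, lim, key]

/-- The Fourier coefficients `λ ↦ a(f, λ)` of an element `f` of `B²(ℝ, ℂ)`. -/
def B2.fourierCoeff : B2 → ℝ → ℂ :=
  SeparationQuotient.lift (fun f => fourierCoeffFun f.toFun) fun f g h =>
    fourierCoeffFun_congr f.mem g.mem ((B2Fun.inseparable_iff f g).1 h)

/-! ### Sets of exponents and Bohr equivalence -/

/-- An enumerated countable (finite or infinite) set `Λ = {λ₁, λ₂, ...}` of distinct real numbers.
The number `size` of its elements may be `⊤`. The indices start at `0`, so that `λⱼ` is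
`freq (j - 1)`, and only the values `freq j` with `j < size` matter. -/
structure Exponents where
  /-- The number of elements. -/
  size : ℕ∞
  /-- The enumeration. -/
  freq : ℕ → ℝ
  /-- The enumerated numbers are distinct. -/
  injOn : Set.InjOn freq {j : ℕ | (j : ℕ∞) < size}

/-- The underlying set `{λ₁, λ₂, ...}`. -/
def Exponents.toSet (Λ : Exponents) : Set ℝ := Λ.freq '' {j : ℕ | (j : ℕ∞) < Λ.size}

/-- The `ℚ`-vector space generated by the first `n` exponents `{λ₁, ..., λₙ}`. -/
def Exponents.V (Λ : Exponents) (n : ℕ) : Submodule ℚ ℝ :=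
  Submodule.span ℚ (Λ.freq '' {j | j < n})

theorem Exponents.freq_mem_V (Λ : Exponents) {n j : ℕ} (h : j < n) : Λ.freq j ∈ Λ.V n :=
  Submodule.subset_span ⟨j, h, rfl⟩

/-- Bohr equivalence of the exponential sums `∑ⱼ a(λⱼ) e^{iλⱼt}` and `∑ⱼ b(λⱼ) e^{iλⱼt}` over `Λ`:
for each `n ≤ #Λ` there is a `ℚ`-linear map `ψ : Vₙ → ℝ` with
`b(λⱼ) = a(λⱼ) e^{iψ(λⱼ)}` for the first `n` exponents. -/
def BohrEquivSums (Λ : Exponents) (a b : ℝ → ℂ) : Prop :=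
  ∀ n : ℕ, (n : ℕ∞) ≤ Λ.size → ∃ ψ : Λ.V n →ₗ[ℚ] ℝ, ∀ (j : ℕ) (hj : j < n),
    b (Λ.freq j) =
      a (Λ.freq j) * Complex.exp (Complex.I * (ψ ⟨Λ.freq j, Λ.freq_mem_V hj⟩ : ℝ))

/-- The class of those `f` in `B²(ℝ, ℂ)` whose Fourier series is of the form
`∑ⱼ aⱼ e^{iλⱼt}` with `λⱼ ∈ Λ`: all Fourier coefficients at exponents outside `Λ` vanish. -/
def classF (Λ : Exponents) : Set B2 := {f | ∀ lam : ℝ, lam ∉ Λ.toSet → f.fourierCoeff lam = 0}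

/-- The equivalence class of `f` under Bohr equivalence, among the elements of `B²(ℝ, ℂ)` whose
Fourier series have their exponents in `Λ`. -/
def bohrClass (Λ : Exponents) (f : B2) : Set B2 :=
  {g | g ∈ classF Λ ∧ BohrEquivSums Λ f.fourierCoeff g.fourierCoeff}

end Besicovitch2

end

/-! On the Fourier side, translation by `τ` multiplies `a(f, λ)` by `e^{iλτ}`. Parseval's identity
for trigonometric polynomials, together with completeness of `B²`, makes `f ↦ a(f, ·)` an isometry
onto `ℓ²(ℝ)` (`fourierEquiv`). Surjectivity lets every character `χ` of the discrete group `ℝ` act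
on `B²` by `a(f, λ) ↦ χ(λ) a(f, λ)`, and the translations are the action of the characters
`e^{iλτ}`.

The characters form a compact space for pointwise convergence. The orbit map `charAct f` is
continuous because `|χ| = 1` makes the `ℓ²` tails uniformly small (`continuous_twist`), and the
exponentials are dense by Kronecker's theorem (`exists_norm_expChar_sub_lt`). Hence the closure of
the translates is the whole compact orbit (`closure_translates`).

The orbit is the Bohr class: on finitely many frequencies a character has the form `e^{iψ}` with `ψ`
`ℚ`-linear (`exists_linearMap_exp_eq`). Conversely the maps `ψₙ` give characters matching more and
more coefficients, and compactness yields one matching them all (`exists_charAct_eq`). A suitable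
`Λ` exists because an `ℓ²` family has countable support. -/

noncomputable section

namespace Besicovitch2

/-! ### Completeness -/

theorem eLpNorm_avg_congr {f g : ℝ → ℂ} {l : ℝ} (h : Set.EqOn f g (Set.Icc (-l) l)) :
    eLpNorm f 2 (avg l) = eLpNorm g 2 (avg l) := by
  rw [← sqMean_rpow, ← sqMean_rpow, sqMean, sqMean,
    setLIntegral_congr_fun measurableSet_Icc fun t ht => by rw [h ht]]

/-- The finite limsup controls only large windows, but one such window already contains `[-L, L]`.
-/
theorem MemB2.setLIntegral_lt_top {f : ℝ → ℂ} (hf : MemB2 f) (L : ℝ) :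
    ∫⁻ t in Set.Icc (-L) L, ‖f t‖ₑ ^ (2 : ℝ) < ∞ := by
  have h := hf.seminorm_lt_top
  rw [seminorm_eq] at h
  obtain ⟨l, h1, hl, hL⟩ := (eventually_lt_of_limsup_lt h).and
    ((eventually_gt_atTop 0).and (eventually_ge_atTop L)) |>.exists
  have hl' : Set.Icc (-L) L ⊆ Set.Icc (-l) l := Set.Icc_subset_Icc (by linarith) hL
  refine (lintegral_mono_set hl').trans_lt ?_
  rw [← sqMean_rpow, sqMean] at h1
  have h2 := (ENNReal.rpow_lt_top_iff_of_pos (by norm_num)).1 h1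
  by_contra h3
  rw [not_lt, top_le_iff] at h3
  rw [h3, ENNReal.mul_top (ENNReal.inv_ne_zero.2 ENNReal.ofReal_ne_top)] at h2
  exact h2.ne rfl

theorem tendsto_inv_ofReal_two_mul :
    Tendsto (fun l : ℝ => (ENNReal.ofReal (2 * l))⁻¹) atTop (𝓝 0) := by
  rw [← ENNReal.inv_top]
  exact tendsto_inv_iff.2
    (ENNReal.tendsto_ofReal_atTop.comp (tendsto_id.const_mul_atTop (by norm_num)))

/-- The Besicovitch seminorm does not see the values on a bounded set. -/
theorem MemB2.seminorm_indicator_eq_zero {f : ℝ → ℂ} (hf : MemB2 f) {s : Set ℝ} {L : ℝ}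
    (hs : s ⊆ Set.Icc (-L) L) : seminorm (s.indicator f) = 0 := by
  have h1 : Tendsto (fun l => sqMean (s.indicator f) l) atTop (𝓝 0) := by
    have h2 : Tendsto (fun l : ℝ => (ENNReal.ofReal (2 * l))⁻¹ *
        ∫⁻ t in Set.Icc (-L) L, ‖f t‖ₑ ^ (2 : ℝ)) atTop (𝓝 0) := by
      rw [← zero_mul (∫⁻ t in Set.Icc (-L) L, ‖f t‖ₑ ^ (2 : ℝ))]
      exact ENNReal.Tendsto.mul_const tendsto_inv_ofReal_two_mul
        (Or.inr (hf.setLIntegral_lt_top L).ne)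
    refine tendsto_of_tendsto_of_tendsto_of_le_of_le tendsto_const_nhds h2
      (fun _ => bot_le) fun l => ?_
    refine mul_le_mul' le_rfl ?_
    rw [← lintegral_indicator measurableSet_Icc (fun t => ‖f t‖ₑ ^ (2 : ℝ))]
    refine (setLIntegral_le_lintegral _ _).trans (lintegral_mono fun t => ?_)
    by_cases ht : t ∈ s
    · simp [ht, hs ht]
    · simp [ht]
  rw [seminorm, h1.limsup_eq]
  simp

theorem seminorm_sum_eq_zero {ι : Type*} (s : Finset ι) (f : ι → ℝ → ℂ)
    (hf : ∀ i ∈ s, AEStronglyMeasurable (f i) volume) (h : ∀ i ∈ s, seminorm (f i) = 0) :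
    seminorm (∑ i ∈ s, f i) = 0 := by
  classical
  induction s using Finset.induction_on with
  | empty => simp [seminorm_zero]
  | insert a s ha ih =>
    rw [Finset.sum_insert ha]
    refine le_antisymm ((seminorm_add_le (hf a (by simp)) ?_).trans_eq ?_) bot_le
    · exact Finset.aestronglyMeasurable_sum s fun i hi => hf i (by simp [hi])
    · rw [h a (by simp), ih (fun i hi => hf i (by simp [hi])) fun i hi => h i (by simp [hi]),
        add_zero]

theorem memB2_of_forall_exists {f : ℝ → ℂ} (hf : AEStronglyMeasurable f volume)
    (h : ∀ ε : ℝ≥0∞, 0 < ε → ∃ g, MemB2 g ∧ seminorm (f - g) < ε) : MemB2 f := by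
  refine ⟨hf, fun ε hε => ?_⟩
  obtain ⟨g, hg, h1⟩ := h (ε / 2) (ENNReal.half_pos hε.ne')
  obtain ⟨P, hP, h2⟩ := hg.2 (ε / 2) (ENNReal.half_pos hε.ne')
  refine ⟨P, hP, ?_⟩
  rw [← sub_add_sub_cancel f g P, ← ENNReal.add_halves ε]
  exact (seminorm_add_le (hf.sub hg.1)
    (hg.1.sub (continuous_of_mem_trigPoly hP).aestronglyMeasurable)).trans_lt
    (ENNReal.add_lt_add h1 h2)

theorem B2Fun.enorm_def (f : B2Fun) : ENNReal.ofReal ‖f‖ = seminorm f.toFun := by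
  rw [norm_def, ENNReal.ofReal_toReal f.mem.seminorm_lt_top.ne]

theorem sum_Ico_two_inv_pow_le (k N : ℕ) :
    ∑ n ∈ Finset.Ico k N, (2⁻¹ : ℝ≥0∞) ^ n ≤ 2 * 2⁻¹ ^ k := by
  rw [Finset.sum_Ico_eq_sum_range]
  simp only [pow_add, ← Finset.mul_sum]
  rw [mul_comm]
  gcongr
  calc _ ≤ ∑' n : ℕ, (2⁻¹ : ℝ≥0∞) ^ n := ENNReal.sum_le_tsum _
    _ = 2 := by rw [ENNReal.tsum_geometric, ENNReal.one_sub_inv_two, inv_inv]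

/-- A limit of a rapidly convergent sequence, obtained by switching from `u n` to `u (n + 1)` at
distance `L n` from the origin. -/
theorem exists_seminorm_sub_le (u : ℕ → B2Fun)
    (hu : ∀ n, seminorm ((u (n + 1)).toFun - (u n).toFun) < 2⁻¹ ^ n) :
    ∃ f : ℝ → ℂ, AEStronglyMeasurable f volume ∧
      ∀ k, seminorm (f - (u k).toFun) ≤ 2 * 2⁻¹ ^ k := by
  set g : ℕ → ℝ → ℂ := fun n => (u (n + 1)).toFun - (u n).toFun with hg
  have hgm : ∀ n, MemB2 (g n) := fun n => (u (n + 1) - u n).mem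
  -- Beyond `L n` every mean of `g n` is small. The requirement `n < L n` makes the series of
  -- truncated differences below locally finite.
  have hL : ∀ n : ℕ, ∃ L : ℝ, (n : ℝ) < L ∧ ∀ l, L ≤ l → eLpNorm (g n) 2 (avg l) ≤ 2⁻¹ ^ n := by
    intro n
    have h := hu n
    rw [seminorm_eq] at h
    obtain ⟨L, hL⟩ := eventually_atTop.1 (eventually_lt_of_limsup_lt h)
    refine ⟨max L (n + 1), ?_, fun l hl => (hL l ((le_max_left _ _).trans hl)).le⟩
    exact (lt_add_one _).trans_le (le_max_right _ _)
  choose L hnL hL using hL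
  set A : ℕ → Set ℝ := fun n => (Set.Ioo (-L n) (L n))ᶜ with hA
  have hAm : ∀ n, MeasurableSet (A n) := fun n => measurableSet_Ioo.compl
  have hAg : ∀ n, AEStronglyMeasurable ((A n).indicator (g n)) volume :=
    fun n => (hgm n).1.indicator (hAm n)
  have hAcg : ∀ n, AEStronglyMeasurable ((A n)ᶜ.indicator (g n)) volume :=
    fun n => (hgm n).1.indicator (hAm n).compl
  have hzero : ∀ (n : ℕ) (t : ℝ), |t| ≤ n → (A n).indicator (g n) t = 0 := by
    intro n t ht
    refine Set.indicator_of_notMem ?_ _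
    simp only [hA, Set.mem_compl_iff, not_not, Set.mem_Ioo, ← abs_lt]
    exact ht.trans_lt (hnL n)
  set F : ℕ → ℝ → ℂ := fun N => (u 0).toFun + ∑ n ∈ Finset.range N, (A n).indicator (g n) with hF
  have hFm : ∀ N, AEStronglyMeasurable (F N) volume := fun N =>
    (u 0).mem.1.add (Finset.aestronglyMeasurable_sum _ fun n _ => hAg n)
  have hstab : ∀ (N M : ℕ) (t : ℝ), |t| ≤ N → N ≤ M → F M t = F N t := by
    intro N M t ht hNM
    induction M, hNM using Nat.le_induction with
    | base => rfl
    | succ M hM ih =>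
      rw [← ih]
      simp only [hF, Finset.sum_range_succ, Pi.add_apply]
      rw [hzero M t (ht.trans (by exact_mod_cast hM)), add_zero]
  set f : ℝ → ℂ := fun t => F ⌈|t|⌉₊ t with hf
  have hfF : ∀ (N : ℕ) (t : ℝ), |t| ≤ N → f t = F N t := fun N t ht =>
    (hstab _ N t (Nat.le_ceil _) (Nat.ceil_le.2 ht)).symm
  have hfm : AEStronglyMeasurable f volume := by
    refine aestronglyMeasurable_of_tendsto_ae atTop hFm (Eventually.of_forall fun t => ?_)
    refine tendsto_const_nhds.congr' ?_
    filter_upwards [eventually_ge_atTop ⌈|t|⌉₊] with N hN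
    exact hfF N t (Nat.ceil_le.1 hN)
  refine ⟨f, hfm, fun k => ?_⟩
  -- `h` collects the pieces of the first `k` differences discarded near the origin; its support is
  -- bounded, so it is invisible to the seminorm.
  set h : ℝ → ℂ := ∑ n ∈ Finset.range k, (A n)ᶜ.indicator (g n) with hh
  have hhm : AEStronglyMeasurable h volume := Finset.aestronglyMeasurable_sum _ fun n _ => hAcg n
  have hh0 : seminorm h = 0 := by
    refine seminorm_sum_eq_zero _ _ (fun n _ => hAcg n) fun n _ => ?_
    refine (hgm n).seminorm_indicator_eq_zero (L := L n) ?_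
    simpa [hA] using Set.Ioo_subset_Icc_self
  -- Valid for every `l`: for `l < L n` the truncated difference vanishes on the whole window.
  have hterm : ∀ (n : ℕ) (l : ℝ), eLpNorm ((A n).indicator (g n)) 2 (avg l) ≤ 2⁻¹ ^ n := by
    intro n l
    rcases le_or_gt (L n) l with hl | hl
    · exact (eLpNorm_indicator_le _).trans (hL n l hl)
    · rw [eLpNorm_avg_congr (g := 0), eLpNorm_zero]
      · exact bot_le
      · intro t ht
        refine Set.indicator_of_notMem ?_ _
        simp only [hA, Set.mem_compl_iff, not_not, Set.mem_Ioo]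
        exact ⟨by linarith [ht.1], by linarith [ht.2]⟩
  have hsplit : ∀ N, k ≤ N →
      F N - (u k).toFun + h = ∑ n ∈ Finset.Ico k N, (A n).indicator (g n) := by
    intro N hN
    have h1 : (u k).toFun = (u 0).toFun + ∑ n ∈ Finset.range k, g n := by
      rw [hg, Finset.sum_range_sub (fun n => (u n).toFun)]
      abel
    have h2 : ∑ n ∈ Finset.range k, g n = h + ∑ n ∈ Finset.range k, (A n).indicator (g n) := by
      rw [hh, ← Finset.sum_add_distrib]
      exact Finset.sum_congr rfl fun n _ => (Set.indicator_compl_add_self _ _).symm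
    rw [h1, h2]
    simp only [hF]
    rw [← Finset.sum_range_add_sum_Ico _ hN]
    abel
  have hmain : seminorm (f - (u k).toFun + h) ≤ 2 * 2⁻¹ ^ k := by
    rw [seminorm_eq]
    refine limsup_le_of_le (by isBoundedDefault) (Eventually.of_forall fun l => ?_)
    -- Large enough for `f = F N` on `[-l, l]`, and at least `k` so that `hsplit` applies.
    set N := max k ⌈l⌉₊ with hN
    rw [eLpNorm_avg_congr (g := F N - (u k).toFun + h), hsplit N (le_max_left _ _)]
    · refine (eLpNorm_sum_le (fun n _ => (hAg n).mono_ac (avg_ac l)) (by norm_num)).trans ?_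
      exact (Finset.sum_le_sum fun n _ => hterm n l).trans (sum_Ico_two_inv_pow_le k N)
    · intro t ht
      simp only [Pi.add_apply, Pi.sub_apply]
      rw [hfF N t]
      refine (abs_le.2 ht).trans ((Nat.le_ceil l).trans ?_)
      exact_mod_cast le_max_right _ _
  have hsub := seminorm_add_le ((hfm.sub (u k).mem.1).add hhm) hhm.neg
  rw [add_neg_cancel_right, seminorm_neg, hh0, add_zero] at hsub
  exact hsub.trans hmain

/-- Only sequences with rate `2⁻ⁿ` need a limit. The patched function is approximated by the members
of the sequence, hence is itself almost periodic. -/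
instance : CompleteSpace B2Fun := by
  refine Metric.complete_of_convergent_controlled_sequences (fun n => 2⁻¹ ^ n)
    (fun n => by positivity) fun u hu => ?_
  have hpow : ∀ n : ℕ, ENNReal.ofReal (2⁻¹ ^ n) = 2⁻¹ ^ n := fun n => by
    rw [ENNReal.ofReal_pow (by norm_num), ENNReal.ofReal_inv_of_pos (by norm_num)]
    simp
  obtain ⟨f, hfm, hf⟩ := exists_seminorm_sub_le u fun n => by
    rw [← B2Fun.toFun_sub, ← B2Fun.enorm_def, ← hpow, ← dist_eq_norm]
    exact (ENNReal.ofReal_lt_ofReal_iff (by positivity)).2 (hu n _ _ (Nat.le_succ n) le_rfl)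
  have hlim : Tendsto (fun k : ℕ => 2 * (2⁻¹ : ℝ≥0∞) ^ k) atTop (𝓝 0) := by
    rw [← mul_zero (2 : ℝ≥0∞)]
    exact ENNReal.Tendsto.const_mul
      (ENNReal.tendsto_pow_atTop_nhds_zero_of_lt_one (by norm_num)) (Or.inr (by norm_num))
  have hfB : MemB2 f := by
    refine memB2_of_forall_exists hfm fun ε hε => ?_
    obtain ⟨k, hk⟩ := (hlim.eventually_lt_const hε).exists
    exact ⟨_, (u k).mem, (hf k).trans_lt hk⟩
  let f' : B2Fun := ⟨f, hfB⟩
  refine ⟨f', ?_⟩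
  rw [tendsto_iff_norm_sub_tendsto_zero]
  have h1 : Tendsto (fun k => seminorm (f - (u k).toFun)) atTop (𝓝 0) :=
    tendsto_of_tendsto_of_tendsto_of_le_of_le tendsto_const_nhds hlim (fun _ => bot_le) hf
  have h2 := (ENNReal.tendsto_toReal ENNReal.zero_ne_top).comp h1
  refine h2.congr fun k => ?_
  rw [norm_sub_rev]
  rfl

/-! ### Fourier coefficients of trigonometric polynomials -/

theorem tendsto_coeffMean_exp (mu lam : ℝ) :
    Tendsto (fun l => coeffMean (fun t => Complex.exp (Complex.I * mu * t)) lam l) atTop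
      (𝓝 (if mu = lam then 1 else 0)) := by
  have hmul : ∀ t : ℝ, Complex.exp (Complex.I * mu * t) * Complex.exp (-(Complex.I * lam * t))
      = Complex.exp (Complex.I * (mu - lam) * t) := fun t => by
    rw [← Complex.exp_add]; ring_nf
  simp only [coeffMean, hmul]
  split_ifs with h
  · refine tendsto_const_nhds.congr' ?_
    filter_upwards [eventually_gt_atTop 0] with l hl
    have hl' : (l : ℂ) ≠ 0 := by exact_mod_cast hl.ne'
    simp [h]
    field_simp
    norm_num
  · have hc : Complex.I * (mu - lam) ≠ 0 :=
      mul_ne_zero Complex.I_ne_zero (sub_ne_zero.2 (by exact_mod_cast h))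
    -- The antiderivative has modulus `1 / |mu - lam|`, so the integral stays below `2 / |mu - lam|`
    -- for all `l`.
    have h0 : Tendsto (fun l : ℝ => (2 * l)⁻¹ * (2 / |mu - lam|)) atTop (𝓝 0) := by
      rw [← zero_mul (2 / |mu - lam|)]
      exact (tendsto_inv_atTop_zero.comp
        (tendsto_id.const_mul_atTop (by norm_num : (0 : ℝ) < 2))).mul_const _
    refine squeeze_zero_norm' ?_ h0
    filter_upwards [eventually_gt_atTop 0] with l hl
    rw [integral_exp_mul_complex hc, norm_mul, norm_inv, Complex.norm_real,
      Real.norm_of_nonneg (by positivity), norm_div]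
    have hn : ‖Complex.I * (mu - lam : ℂ)‖ = |mu - lam| := by
      rw [norm_mul, Complex.norm_I, one_mul, ← Complex.ofReal_sub, Complex.norm_real,
        Real.norm_eq_abs]
    have he : ∀ x : ℝ, ‖Complex.exp (Complex.I * (mu - lam) * x)‖ = 1 := fun x => by
      have : Complex.I * (mu - lam) * x = (((mu - lam) * x : ℝ) : ℂ) * Complex.I := by
        push_cast; ring
      rw [this, Complex.norm_exp_ofReal_mul_I]
    rw [hn]
    gcongr
    refine (norm_sub_le _ _).trans ?_
    rw [he, he]
    norm_num

theorem norm_exp_I_mul (lam t : ℝ) : ‖Complex.exp (Complex.I * lam * t)‖ = 1 := by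
  have : Complex.I * lam * t = ((lam * t : ℝ) : ℂ) * Complex.I := by push_cast; ring
  rw [this, Complex.norm_exp_ofReal_mul_I]

/-- The trigonometric polynomial `t ↦ ∑ c(λ) e^{iλt}`. -/
def trigSum : (ℝ →₀ ℂ) →ₗ[ℂ] (ℝ → ℂ) :=
  Finsupp.linearCombination ℂ fun (lam : ℝ) (t : ℝ) => Complex.exp (Complex.I * lam * t)

theorem trigSum_apply (c : ℝ →₀ ℂ) (t : ℝ) :
    trigSum c t = ∑ mu ∈ c.support, c mu * Complex.exp (Complex.I * mu * t) := by
  simp [trigSum, Finsupp.linearCombination_apply, Finsupp.sum]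

theorem trigSum_mem (c : ℝ →₀ ℂ) : trigSum c ∈ trigPoly := by
  rw [trigPoly, ← Finsupp.range_linearCombination]
  exact ⟨c, rfl⟩

theorem exists_trigSum_eq {P : ℝ → ℂ} (hP : P ∈ trigPoly) : ∃ c, trigSum c = P := by
  rwa [trigPoly, ← Finsupp.range_linearCombination] at hP

theorem coeffMean_sum {ι : Type*} (s : Finset ι) (c : ι → ℂ) (f : ι → ℝ → ℂ)
    (hf : ∀ i, Continuous (f i)) (lam l : ℝ) :
    coeffMean (fun t => ∑ i ∈ s, c i * f i t) lam l = ∑ i ∈ s, c i * coeffMean (f i) lam l := by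
  simp only [coeffMean, Finset.sum_mul]
  rw [intervalIntegral.integral_finsetSum, Finset.mul_sum]
  · refine Finset.sum_congr rfl fun i _ => ?_
    simp only [mul_assoc (c i)]
    rw [intervalIntegral.integral_const_mul, mul_left_comm]
  · intro i _
    have := hf i
    exact Continuous.intervalIntegrable (by fun_prop) _ _

theorem tendsto_coeffMean_trigSum (c : ℝ →₀ ℂ) (lam : ℝ) :
    Tendsto (fun l => coeffMean (trigSum c) lam l) atTop (𝓝 (c lam)) := by
  have h1 : trigSum c = fun t : ℝ => ∑ mu ∈ c.support, c mu * Complex.exp (Complex.I * mu * t) :=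
    funext (trigSum_apply c)
  simp only [h1]
  have h2 : c lam = ∑ mu ∈ c.support, c mu * (if mu = lam then 1 else 0) := by
    simp
  rw [h2]
  refine (tendsto_finsetSum _ fun mu _ => (tendsto_coeffMean_exp mu lam).const_mul (c mu)).congr
    fun l => ?_
  rw [coeffMean_sum _ _ (fun (mu : ℝ) (t : ℝ) => Complex.exp (Complex.I * mu * t))
    fun mu => by fun_prop]

/-! ### Kronecker's theorem -/

theorem norm_coeff_le_of_norm_trigSum_le (c : ℝ →₀ ℂ) {C : ℝ} (hC : ∀ t, ‖trigSum c t‖ ≤ C)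
    (lam : ℝ) : ‖c lam‖ ≤ C := by
  refine le_of_tendsto (tendsto_coeffMean_trigSum c lam).norm ?_
  filter_upwards [eventually_gt_atTop 0] with l hl
  have h := intervalIntegral.norm_integral_le_of_norm_le_const (a := -l) (b := l)
    (f := fun t => trigSum c t * Complex.exp (-(Complex.I * lam * t))) (C := C) fun t _ => by
      rw [norm_mul, norm_exp_neg, mul_one]
      exact hC t
  rw [coeffMean, norm_mul, norm_inv, Complex.norm_real, Real.norm_of_nonneg (by positivity)]
  rw [sub_neg_eq_add, ← two_mul, abs_of_pos (by positivity)] at h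
  rw [inv_mul_le_iff₀ (by positivity), mul_comm (2 * l)]
  exact h

/-- The character `λ ↦ e^{iλt}` of `ℝ`. -/
def expChar (t : ℝ) : Multiplicative ℝ →* ℂ where
  toFun lam := Complex.exp (Complex.I * lam.toAdd * t)
  map_one' := by simp
  map_mul' x y := by rw [← Complex.exp_add, toAdd_mul]; push_cast; ring_nf

/-- The evaluation of a formal exponential sum at a character. -/
abbrev evalChar (χ : Multiplicative ℝ →* ℂ) : AddMonoidAlgebra ℂ ℝ →ₐ[ℂ] ℂ :=
  AddMonoidAlgebra.lift ℂ ℂ ℝ χ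

theorem evalChar_expChar (P : AddMonoidAlgebra ℂ ℝ) (t : ℝ) :
    evalChar (expChar t) P = trigSum P.coeff t := by
  rw [trigSum_apply, AddMonoidAlgebra.lift_apply, Finsupp.sum]
  rfl

/-- Each coefficient is bounded by `C`, being a mean value. The factor counting the terms is a loss,
removed below by passing to powers of `P`. -/
theorem norm_evalChar_le (χ : Multiplicative ℝ →* ℂ) (hχ : ∀ x, ‖χ x‖ = 1)
    (P : AddMonoidAlgebra ℂ ℝ) {C : ℝ} (hC : ∀ t, ‖evalChar (expChar t) P‖ ≤ C) :
    ‖evalChar χ P‖ ≤ P.coeff.support.card * C := by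
  rw [AddMonoidAlgebra.lift_apply, Finsupp.sum, ← nsmul_eq_mul]
  refine (norm_sum_le _ _).trans (Finset.sum_le_card_nsmul _ _ _ fun lam _ => ?_)
  rw [norm_smul, hχ, mul_one]
  exact norm_coeff_le_of_norm_trigSum_le _ (fun t => by rw [← evalChar_expChar]; exact hC t) lam

/-- The exponents of `P ^ p` are sums `∑ kₛ s` over the support of `P` with `0 ≤ kₛ ≤ p`. What
matters is that the bound is polynomial in `p`. -/
theorem card_support_pow_le (P : AddMonoidAlgebra ℂ ℝ) (p : ℕ) :
    (P ^ p).coeff.support.card ≤ (p + 1) ^ P.coeff.support.card := by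
  classical
  set S := P.coeff.support with hS
  have key : ∀ p : ℕ, (P ^ p).coeff.support ⊆
      (Fintype.piFinset fun _ : S => Finset.range (p + 1)).image
        fun k => ∑ s : S, (k s : ℝ) * (s : ℝ) := by
    intro p
    induction p with
    | zero =>
      intro x hx
      have : x = 0 := by
        by_contra h
        simp [AddMonoidAlgebra.one_def] at hx
        exact h hx
      simp only [Finset.mem_image, Fintype.mem_piFinset]
      exact ⟨0, by simp, by simp [this]⟩
    | succ p ih =>
      intro x hx
      rw [pow_succ] at hx
      obtain ⟨y, hy, s, hs, rfl⟩ := Finset.mem_add.1 (AddMonoidAlgebra.support_coeff_mul_subset _ _ hx)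
      obtain ⟨k, hk, rfl⟩ := Finset.mem_image.1 (ih hy)
      simp only [Finset.mem_image, Fintype.mem_piFinset, Finset.mem_range] at hk ⊢
      refine ⟨k + Pi.single ⟨s, hs⟩ 1, fun i => ?_, ?_⟩
      · have := hk i
        have h2 : (Pi.single (⟨s, hs⟩ : S) 1 : S → ℕ) i ≤ 1 := by
          rw [Pi.single_apply]; split_ifs <;> simp
        simp only [Pi.add_apply]
        omega
      · simp [add_mul, Finset.sum_add_distrib, Pi.single_apply]
  refine (Finset.card_le_card (key p)).trans (Finset.card_image_le.trans ?_)
  simp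

/-- A finite exponential sum is bounded at every character of `ℝ` by its supremum over the
continuous characters. -/
theorem norm_evalChar_le_of_forall_norm_le (χ : Multiplicative ℝ →* ℂ) (hχ : ∀ x, ‖χ x‖ = 1)
    (P : AddMonoidAlgebra ℂ ℝ) {C : ℝ} (hC0 : 0 < C) (hC : ∀ t, ‖evalChar (expChar t) P‖ ≤ C) :
    ‖evalChar χ P‖ ≤ C := by
  set n := P.coeff.support.card
  -- Power trick: evaluation is multiplicative, so the crude bound for `P ^ p` loses only a factor
  -- polynomial in `p`.
  have h1 : ∀ p : ℕ, (‖evalChar χ P‖ / C) ^ p ≤ ((p : ℝ) + 1) ^ n := by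
    intro p
    have h2 := norm_evalChar_le χ hχ (P ^ p) (C := C ^ p) fun t => by
      rw [map_pow, norm_pow]
      exact pow_le_pow_left₀ (norm_nonneg _) (hC t) p
    rw [map_pow, norm_pow] at h2
    rw [div_pow, div_le_iff₀ (by positivity)]
    refine h2.trans ?_
    gcongr
    exact_mod_cast card_support_pow_le P p
  by_contra! h
  have hr : 1 < ‖evalChar χ P‖ / C := (one_lt_div hC0).2 h
  set r := ‖evalChar χ P‖ / C
  have h3 := (tendsto_pow_const_div_const_pow_of_one_lt n hr).comp (tendsto_add_atTop_nat 1)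
  -- The threshold `r⁻¹` absorbs the index shift: `(p + 1) ^ n / r ^ (p + 1) < r⁻¹` says `(p + 1) ^
  -- n < r ^ p`.
  have h4 := h3.eventually_lt_const (show (0 : ℝ) < r⁻¹ by positivity)
  obtain ⟨p, hp⟩ := h4.exists
  simp only [Function.comp_apply, Nat.cast_add, Nat.cast_one] at hp
  rw [div_lt_iff₀ (by positivity), pow_succ' r, inv_mul_cancel_left₀ (by positivity)] at hp
  exact absurd (h1 p) (not_le.2 hp)

theorem normSq_sub_of_norm_eq_one {z w : ℂ} (hz : ‖z‖ = 1) (hw : ‖w‖ = 1) :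
    (2 + (starRingEnd ℂ w * z + w * starRingEnd ℂ z) : ℂ) = ((4 - ‖z - w‖ ^ 2 : ℝ) : ℂ) := by
  have h1 := Complex.conj_mul' (z - w)
  have h2 := Complex.conj_mul' z
  have h3 := Complex.conj_mul' w
  rw [hz] at h2
  rw [hw] at h3
  push_cast at h2 h3 ⊢
  rw [← h1, map_sub]
  linear_combination h2 + h3

/-- Kronecker's theorem: every character of the discrete group `ℝ` is a pointwise limit of
continuous characters. -/
theorem exists_norm_expChar_sub_lt (χ : Multiplicative ℝ →* ℂ) (hχ : ∀ x, ‖χ x‖ = 1)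
    (S : Finset ℝ) {ε : ℝ} (hε : 0 < ε) :
    ∃ t : ℝ, ∀ lam ∈ S, ‖expChar t (.ofAdd lam) - χ (.ofAdd lam)‖ < ε := by
  by_contra! hcon
  have hconj : ∀ (ξ : Multiplicative ℝ →* ℂ), (∀ x, ‖ξ x‖ = 1) → ∀ lam : ℝ,
      ξ (.ofAdd (-lam)) = starRingEnd ℂ (ξ (.ofAdd lam)) := fun ξ hξ lam => by
    have h1 : ξ (.ofAdd (-lam)) * ξ (.ofAdd lam) = 1 := by
      rw [← map_mul, ← ofAdd_add, neg_add_cancel, ofAdd_zero, map_one]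
    have h2 : starRingEnd ℂ (ξ (.ofAdd lam)) * ξ (.ofAdd lam) = 1 := by
      rw [Complex.conj_mul', hξ]; simp
    exact mul_right_cancel₀ (right_ne_zero_of_mul_eq_one h1) (h1.trans h2.symm)
  have hexp : ∀ t x, ‖expChar t x‖ = 1 := fun t x => norm_exp_I_mul _ _
  -- A test sum whose value at a unitary character `ξ` is `∑ (4 - |ξ(λ) - χ(λ)|²)`. It equals `4
  -- |S|` at `χ`, but a failure of approximation keeps it at most `4 |S| - ε²` at all continuous
  -- characters.
  let P : AddMonoidAlgebra ℂ ℝ := ∑ lam ∈ S, (algebraMap ℂ _ 2 +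
    (AddMonoidAlgebra.single lam (starRingEnd ℂ (χ (.ofAdd lam))) +
      AddMonoidAlgebra.single (-lam) (χ (.ofAdd lam))))
  have hP : ∀ (ξ : Multiplicative ℝ →* ℂ), (∀ x, ‖ξ x‖ = 1) → evalChar ξ P =
      ((∑ lam ∈ S, (4 - ‖ξ (.ofAdd lam) - χ (.ofAdd lam)‖ ^ 2) : ℝ) : ℂ) := fun ξ hξ => by
    simp only [P, map_sum, map_add, AlgHom.commutes, Complex.ofReal_sum]
    refine Finset.sum_congr rfl fun lam _ => ?_
    rw [← normSq_sub_of_norm_eq_one (hξ _) (hχ _), AddMonoidAlgebra.lift_single,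
      AddMonoidAlgebra.lift_single, hconj ξ hξ]
    simp
  have hS : S.Nonempty := by
    obtain ⟨lam, h, -⟩ := hcon 0
    exact ⟨lam, h⟩
  have hnn : ∀ t, ∀ lam ∈ S, 0 ≤ 4 - ‖expChar t (.ofAdd lam) - χ (.ofAdd lam)‖ ^ 2 := by
    intro t lam _
    have := norm_sub_le (expChar t (.ofAdd lam)) (χ (.ofAdd lam))
    rw [hexp, hχ] at this
    nlinarith [norm_nonneg (expChar t (.ofAdd lam) - χ (.ofAdd lam))]
  have hsum : ∀ t, ∑ lam ∈ S, (4 - ‖expChar t (.ofAdd lam) - χ (.ofAdd lam)‖ ^ 2)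
      ≤ S.card * 4 - ε ^ 2 := by
    intro t
    obtain ⟨lam, hlam, h⟩ := hcon t
    rw [Finset.sum_sub_distrib, Finset.sum_const, nsmul_eq_mul]
    gcongr
    refine le_trans ?_ (Finset.single_le_sum
      (f := fun lam => ‖expChar t (.ofAdd lam) - χ (.ofAdd lam)‖ ^ 2)
      (fun _ _ => by positivity) hlam)
    gcongr
  have hb : ∀ t, ‖evalChar (expChar t) P‖ ≤ S.card * 4 - ε ^ 2 := fun t => by
    rw [hP _ (hexp t), Complex.norm_real,
      Real.norm_of_nonneg (Finset.sum_nonneg (hnn t))]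
    exact hsum t
  -- Replacing `ε²` by `min (ε²) 1` keeps the bound positive, as the power trick requires.
  have hpos : (0 : ℝ) < S.card * 4 - min (ε ^ 2) 1 := by
    have : (1 : ℝ) ≤ S.card := by exact_mod_cast hS.card_pos
    linarith [min_le_right (ε ^ 2) 1]
  have h := norm_evalChar_le_of_forall_norm_le χ hχ P hpos fun t =>
    (hb t).trans (by linarith [min_le_left (ε ^ 2) 1])
  rw [hP χ hχ, Complex.norm_real] at h
  simp only [sub_self, norm_zero, Finset.sum_const, nsmul_eq_mul] at h
  rw [Real.norm_of_nonneg (by positivity)] at h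
  norm_num only at h
  have : (0 : ℝ) < min (ε ^ 2) 1 := by positivity
  linarith

/-! ### The vector space structure -/

theorem MemB2.const_smul {f : ℝ → ℂ} (hf : MemB2 f) (c : ℂ) : MemB2 (c • f) := by
  refine ⟨hf.1.const_smul c, fun ε hε => ?_⟩
  rcases eq_or_ne c 0 with rfl | hc
  · exact ⟨0, zero_mem _, by simpa [seminorm_zero] using hε⟩
  have h0 : ‖c‖ₑ ≠ 0 := by simpa using hc
  have ht : ‖c‖ₑ ≠ ∞ := by simp
  obtain ⟨P, hP, h⟩ := hf.2 (ε / ‖c‖ₑ) (ENNReal.div_pos hε.ne' ht)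
  refine ⟨c • P, Submodule.smul_mem _ c hP, ?_⟩
  rw [← smul_sub, seminorm_const_smul, mul_comm]
  exact (ENNReal.lt_div_iff_mul_lt (Or.inl h0) (Or.inl ht)).1 h

namespace B2Fun

theorem toFun_injective : Function.Injective toFun := Subtype.val_injective

/-- The underlying function, as an additive map. -/
def toFunHom : B2Fun →+ (ℝ → ℂ) where
  toFun := toFun
  map_zero' := toFun_zero
  map_add' := toFun_add

instance : SMul ℂ B2Fun := ⟨fun c f => ⟨c • f.toFun, f.mem.const_smul c⟩⟩

@[simp] theorem toFun_smul (c : ℂ) (f : B2Fun) : (c • f).toFun = c • f.toFun := rfl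

instance : Module ℂ B2Fun := Function.Injective.module ℂ toFunHom toFun_injective toFun_smul

instance : NormedSpace ℂ B2Fun where
  norm_smul_le c f := by
    rw [norm_def, toFun_smul, seminorm_const_smul, ENNReal.toReal_mul, toReal_enorm, norm_def]

end B2Fun

theorem memB2_of_mem_trigPoly {P : ℝ → ℂ} (hP : P ∈ trigPoly) : MemB2 P :=
  ⟨(continuous_of_mem_trigPoly hP).aestronglyMeasurable, fun ε hε =>
    ⟨P, hP, by simpa [seminorm_zero] using hε⟩⟩

/-- The trigonometric polynomial `∑ c(λ) e^{iλt}` as an almost periodic function. -/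
def trigSumFun : (ℝ →₀ ℂ) →ₗ[ℂ] B2Fun where
  toFun c := ⟨trigSum c, memB2_of_mem_trigPoly (trigSum_mem c)⟩
  map_add' c d := B2Fun.toFun_injective (map_add trigSum c d)
  map_smul' a c := B2Fun.toFun_injective (map_smul trigSum a c)

theorem toFun_trigSumFun (c : ℝ →₀ ℂ) : (trigSumFun c).toFun = trigSum c := rfl

/-- The trigonometric polynomial `∑ c(λ) e^{iλt}` as an element of `B²(ℝ, ℂ)`. -/
def trigSumB2 : (ℝ →₀ ℂ) →ₗ[ℂ] B2 :=
  (SeparationQuotient.mkCLM ℂ B2Fun).toLinearMap ∘ₗ trigSumFun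

theorem trigSumB2_apply (c : ℝ →₀ ℂ) : trigSumB2 c = SeparationQuotient.mk (trigSumFun c) := rfl

theorem denseRange_trigSumB2 : DenseRange trigSumB2 := by
  refine SeparationQuotient.surjective_mk.forall.2 fun f => ?_
  rw [Metric.mem_closure_range_iff]
  intro ε hε
  obtain ⟨P, hP, h⟩ := f.mem.2 (ENNReal.ofReal ε) (by simpa using hε)
  obtain ⟨c, rfl⟩ := exists_trigSum_eq hP
  refine ⟨c, ?_⟩
  rw [trigSumB2_apply, SeparationQuotient.dist_mk, dist_eq_norm, B2Fun.norm_def]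
  exact (ENNReal.lt_ofReal_iff_toReal_lt h.ne_top).1 h

/-! ### Parseval's identity -/

theorem sqMean_eq_ofReal {f : ℝ → ℂ} (hf : Continuous f) {l : ℝ} (hl : 0 < l) :
    sqMean f l = ENNReal.ofReal ((2 * l)⁻¹ * ∫ t in (-l)..l, ‖f t‖ ^ 2) := by
  rw [ENNReal.ofReal_mul (by positivity), ENNReal.ofReal_inv_of_pos (by positivity), sqMean,
    intervalIntegral.integral_of_le (by linarith), ← integral_Icc_eq_integral_Ioc,
    ofReal_integral_eq_lintegral_ofReal]
  · congr 1
    refine lintegral_congr fun t => ?_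
    rw [ENNReal.ofReal_pow (norm_nonneg _), ofReal_norm]
    norm_cast
  · exact (hf.norm.pow 2).continuousOn.integrableOn_Icc
  · exact Eventually.of_forall fun t => by positivity

/-- Expanding only the conjugate factor turns the mean of `|P|²` into a combination of the means
defining the coefficients of `P`, so Parseval needs no double sum. -/
theorem norm_sq_trigSum (c : ℝ →₀ ℂ) (t : ℝ) : ((‖trigSum c t‖ ^ 2 : ℝ) : ℂ) =
    ∑ lam ∈ c.support, starRingEnd ℂ (c lam) *
      (trigSum c t * Complex.exp (-(Complex.I * lam * t))) := by
  have h1 := Complex.conj_mul' (trigSum c t)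
  push_cast
  rw [← h1]
  nth_rw 1 [trigSum_apply]
  rw [map_sum, Finset.sum_mul]
  refine Finset.sum_congr rfl fun lam _ => ?_
  rw [map_mul, ← Complex.exp_conj]
  simp only [map_mul, Complex.conj_I, Complex.conj_ofReal]
  ring_nf

theorem tendsto_sqMean_trigSum (c : ℝ →₀ ℂ) :
    Tendsto (fun l => sqMean (trigSum c) l) atTop
      (𝓝 (ENNReal.ofReal (∑ lam ∈ c.support, ‖c lam‖ ^ 2))) := by
  have hc := continuous_of_mem_trigPoly (trigSum_mem c)
  have h1 : Tendsto (fun l : ℝ => (((2 * l)⁻¹ * ∫ t in (-l)..l, ‖trigSum c t‖ ^ 2 : ℝ) : ℂ)) atTop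
      (𝓝 ((∑ lam ∈ c.support, ‖c lam‖ ^ 2 : ℝ) : ℂ)) := by
    have h2 : ((∑ lam ∈ c.support, ‖c lam‖ ^ 2 : ℝ) : ℂ)
        = ∑ lam ∈ c.support, starRingEnd ℂ (c lam) * c lam := by
      push_cast
      exact Finset.sum_congr rfl fun lam _ => (Complex.conj_mul' _).symm
    rw [h2]
    refine (tendsto_finsetSum _ fun lam _ =>
      (tendsto_coeffMean_trigSum c lam).const_mul (starRingEnd ℂ (c lam))).congr fun l => ?_
    rw [Complex.ofReal_mul, ← intervalIntegral.integral_ofReal]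
    simp only [norm_sq_trigSum]
    rw [intervalIntegral.integral_finsetSum, Finset.mul_sum]
    · refine Finset.sum_congr rfl fun lam _ => ?_
      rw [intervalIntegral.integral_const_mul, coeffMean, mul_left_comm, Complex.ofReal_inv]
    · intro lam _
      exact Continuous.intervalIntegrable (by fun_prop) _ _
  have h3 := (Complex.continuous_re.tendsto _).comp h1
  refine (ENNReal.tendsto_ofReal h3).congr' ?_
  filter_upwards [eventually_gt_atTop 0] with l hl
  rw [sqMean_eq_ofReal hc hl]
  rfl

theorem norm_trigSumB2 (c : ℝ →₀ ℂ) : ‖trigSumB2 c‖ = √(∑ lam ∈ c.support, ‖c lam‖ ^ 2) := by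
  rw [trigSumB2_apply, SeparationQuotient.norm_mk, B2Fun.norm_def]
  rw [toFun_trigSumFun, seminorm, (tendsto_sqMean_trigSum c).limsup_eq, ← ENNReal.toReal_rpow,
    ENNReal.toReal_ofReal (by positivity), Real.sqrt_eq_rpow]

/-- The Hilbert space `ℓ²(ℝ)` of families of Fourier coefficients. -/
abbrev CoeffSpace : Type := lp (fun _ : ℝ => ℂ) 2

/-- A finitely supported family as an element of `ℓ²(ℝ)`. -/
def finsuppCoeff : (ℝ →₀ ℂ) →ₗ[ℂ] CoeffSpace :=
  Finsupp.linearCombination ℂ fun lam : ℝ => lp.single 2 lam (1 : ℂ)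

theorem finsuppCoeff_eq_sum (c : ℝ →₀ ℂ) :
    finsuppCoeff c = ∑ lam ∈ c.support, lp.single (E := fun _ : ℝ => ℂ) 2 lam (c lam) := by
  rw [finsuppCoeff, Finsupp.linearCombination_apply, Finsupp.sum]
  refine Finset.sum_congr rfl fun lam _ => ?_
  rw [← lp.single_smul, smul_eq_mul, mul_one]

theorem finsuppCoeff_apply (c : ℝ →₀ ℂ) (lam : ℝ) : finsuppCoeff c lam = c lam := by
  rw [finsuppCoeff_eq_sum, lp.coeFn_sum, Finset.sum_apply]
  simp only [lp.single_apply, Finset.sum_pi_single]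
  simp [eq_comm]

theorem norm_finsuppCoeff (c : ℝ →₀ ℂ) :
    ‖finsuppCoeff c‖ = √(∑ lam ∈ c.support, ‖c lam‖ ^ 2) := by
  have h := lp.norm_sum_single (E := fun _ : ℝ => ℂ) (p := 2) (by simp) (fun lam => c lam) c.support
  rw [← finsuppCoeff_eq_sum] at h
  simp only [ENNReal.toReal_ofNat, Real.rpow_ofNat] at h
  rw [← h, Real.sqrt_sq (norm_nonneg _)]

theorem denseRange_finsuppCoeff : DenseRange finsuppCoeff := by
  intro x
  refine mem_closure_of_tendsto (lp.hasSum_single (by simp) x) (Eventually.of_forall fun s => ?_)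
  refine ⟨∑ lam ∈ s, Finsupp.single lam (x lam), ?_⟩
  rw [map_sum]
  refine Finset.sum_congr rfl fun lam _ => ?_
  rw [finsuppCoeff, Finsupp.linearCombination_single, ← lp.single_smul, smul_eq_mul, mul_one]

/-- The Fourier transform: an isometric isomorphism of `B²(ℝ, ℂ)` onto `ℓ²(ℝ)`. -/
def fourierEquiv : B2 ≃ₗᵢ[ℂ] CoeffSpace :=
  -- Finitely supported families are dense on both sides with equal norms. Both spaces are complete,
  -- so the extension is bijective.
  (LinearEquiv.refl ℂ (ℝ →₀ ℂ)).extendOfIsometry trigSumB2 finsuppCoeff denseRange_trigSumB2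
    denseRange_finsuppCoeff fun c => by
      rw [LinearEquiv.refl_apply, norm_trigSumB2, norm_finsuppCoeff]

theorem fourierEquiv_trigSumB2 (c : ℝ →₀ ℂ) : fourierEquiv (trigSumB2 c) = finsuppCoeff c :=
  LinearEquiv.extendOfIsometry_eq ..

theorem continuous_fourierEquiv_apply (lam : ℝ) : Continuous fun f : B2 => fourierEquiv f lam :=
  ((lp.evalCLM ℂ (fun _ : ℝ => ℂ) 2 lam).continuous).comp fourierEquiv.continuous

/-- The means defining the Fourier coefficients converge. -/
theorem tendsto_coeffMean (f : B2Fun) (lam : ℝ) :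
    Tendsto (fun l => coeffMean f.toFun lam l) atTop
      (𝓝 (fourierEquiv (SeparationQuotient.mk f) lam)) := by
  rw [Metric.tendsto_nhds]
  intro ε hε
  obtain ⟨P, hP, h⟩ := f.mem.2 (ENNReal.ofReal (ε / 3)) (by simpa using hε)
  obtain ⟨c, rfl⟩ := exists_trigSum_eq hP
  have hc : MemB2 (trigSum c) := memB2_of_mem_trigPoly (trigSum_mem c)
  -- An `ε/3` argument: both the limiting coefficient and the means move by at most the Besicovitch
  -- distance from `f` to the polynomial.
  have h1 : ‖c lam - fourierEquiv (SeparationQuotient.mk f) lam‖ < ε / 3 := by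
    rw [← finsuppCoeff_apply, ← fourierEquiv_trigSumB2]
    change ‖(fourierEquiv (trigSumB2 c) - fourierEquiv (SeparationQuotient.mk f) : CoeffSpace) lam‖
      < _
    refine (lp.norm_apply_le_norm (by simp) _ lam).trans_lt ?_
    rw [← map_sub, LinearIsometryEquiv.norm_map, norm_sub_rev, trigSumB2_apply,
      ← SeparationQuotient.mk_sub, SeparationQuotient.norm_mk, B2Fun.norm_def]
    exact (ENNReal.lt_ofReal_iff_toReal_lt h.ne_top).1 h
  rw [seminorm_eq] at h
  have h2 := Metric.tendsto_nhds.1 (tendsto_coeffMean_trigSum c lam) (ε / 3) (by positivity)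
  filter_upwards [eventually_lt_of_limsup_lt h, h2, eventually_gt_atTop 0,
    f.mem.eventually_intervalIntegrable lam, hc.eventually_intervalIntegrable lam]
    with l h3 h4 hl hi hi'
  have h5 : ‖coeffMean f.toFun lam l - coeffMean (trigSum c) lam l‖ < ε / 3 := by
    have h6 := (enorm_coeffMean_le (f.mem.1.sub hc.1) lam hl).trans_lt h3
    rw [← ofReal_norm] at h6
    have h7 := (ENNReal.ofReal_lt_ofReal_iff (by positivity)).1 h6
    refine lt_of_eq_of_lt ?_ h7
    congr 1
    simp only [coeffMean, ← mul_sub, ← intervalIntegral.integral_sub hi hi', Pi.sub_apply, sub_mul]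
  rw [dist_eq_norm] at h4 ⊢
  calc _ = ‖(coeffMean f.toFun lam l - coeffMean (trigSum c) lam l) +
        (coeffMean (trigSum c) lam l - c lam) +
        (c lam - fourierEquiv (SeparationQuotient.mk f) lam)‖ := by congr 1; ring
    _ < ε := (norm_add₃_le).trans_lt (by linarith)

/-- Convergence of the means makes `limUnder` a genuine limit rather than a default value. -/
theorem fourierCoeff_eq (f : B2) (lam : ℝ) : f.fourierCoeff lam = fourierEquiv f lam := by
  obtain ⟨f, rfl⟩ := SeparationQuotient.surjective_mk f
  exact (tendsto_coeffMean f lam).limUnder_eq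

/-! ### Translation on the Fourier side -/

theorem continuous_translate (τ : ℝ) : Continuous (B2.translate τ) := by
  refine LipschitzWith.continuous (K := 1) (LipschitzWith.of_dist_le_mul ?_)
  refine SeparationQuotient.surjective_mk.forall₂.2 fun f g => ?_
  change dist (SeparationQuotient.mk (f.translate τ)) (SeparationQuotient.mk (g.translate τ)) ≤ _
  rw [SeparationQuotient.dist_mk, SeparationQuotient.dist_mk, NNReal.coe_one, one_mul,
    dist_eq_norm, dist_eq_norm, B2Fun.norm_def, B2Fun.norm_def]
  exact ENNReal.toReal_mono (f - g).mem.seminorm_lt_top.ne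
    (seminorm_translate_le (f.toFun - g.toFun) τ)

/-- Both sides are continuous in `f`, so trigonometric polynomials suffice. -/
theorem fourierEquiv_translate (τ : ℝ) (f : B2) (lam : ℝ) :
    fourierEquiv (f.translate τ) lam = expChar τ (.ofAdd lam) * fourierEquiv f lam := by
  revert f
  refine fun f => denseRange_trigSumB2.induction_on f ?_ fun c => ?_
  · exact isClosed_eq ((continuous_fourierEquiv_apply lam).comp (continuous_translate τ))
      (continuous_const.mul (continuous_fourierEquiv_apply lam))
  let d : ℝ →₀ ℂ := Finsupp.onFinset c.support (fun mu => expChar τ (.ofAdd mu) * c mu)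
    fun mu h => Finsupp.mem_support_iff.2 (right_ne_zero_of_mul h)
  have h : trigSum d = fun t => trigSum c (t + τ) := by
    funext t
    rw [trigSum_apply, trigSum_apply]
    refine (Finset.sum_subset Finsupp.support_onFinset_subset fun mu _ h0 => ?_).trans
      (Finset.sum_congr rfl fun mu _ => ?_)
    · rw [Finsupp.notMem_support_iff.1 h0, zero_mul]
    · simp only [d, Finsupp.onFinset_apply, expChar, MonoidHom.coe_mk, OneHom.coe_mk, toAdd_ofAdd]
      rw [mul_right_comm, ← Complex.exp_add, mul_comm]
      push_cast
      ring_nf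
  have h1 : B2.translate τ (trigSumB2 c) = trigSumB2 d :=
    congrArg SeparationQuotient.mk (B2Fun.toFun_injective h.symm)
  rw [h1, fourierEquiv_trigSumB2, fourierEquiv_trigSumB2, finsuppCoeff_apply, finsuppCoeff_apply]
  rfl

/-! ### The compact group of characters of the discrete group `ℝ` -/

/-- The characters of the discrete additive group `ℝ`, as a set of functions. -/
def charSet : Set (ℝ → ℂ) := {χ | (∀ x, ‖χ x‖ = 1) ∧ ∀ x y, χ (x + y) = χ x * χ y}

theorem isClosed_charSet : IsClosed charSet := by
  simp only [charSet, Set.ofPred_and, Set.ofPred_forall]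
  refine (isClosed_iInter fun x => ?_).inter (isClosed_iInter fun x => isClosed_iInter fun y => ?_)
  · exact isClosed_eq (by fun_prop) (by fun_prop)
  · exact isClosed_eq (by fun_prop) (by fun_prop)

/-- Tychonoff: a closed subset of a product of closed unit discs. -/
theorem isCompact_charSet : IsCompact charSet := by
  refine (isCompact_univ_pi fun _ : ℝ => isCompact_closedBall (0 : ℂ) 1).of_isClosed_subset
    isClosed_charSet fun χ hχ x _ => ?_
  simpa using (hχ.1 x).le

instance : CompactSpace charSet := isCompact_iff_compactSpace.1 isCompact_charSet

theorem map_zero_of_mem_charSet {χ : ℝ → ℂ} (hχ : χ ∈ charSet) : χ 0 = 1 := by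
  have h := hχ.2 0 0
  have h0 : χ 0 ≠ 0 := norm_ne_zero_iff.1 (by rw [hχ.1]; norm_num)
  rw [add_zero] at h
  exact (mul_eq_left₀ h0).1 h.symm

/-- A character, as a homomorphism. -/
def charHom (χ : charSet) : Multiplicative ℝ →* ℂ where
  toFun x := χ.1 x.toAdd
  map_one' := map_zero_of_mem_charSet χ.2
  map_mul' x y := χ.2.2 x.toAdd y.toAdd

/-- The character `λ ↦ e^{iλt}`. -/
def contChar (t : ℝ) : charSet :=
  ⟨fun lam => expChar t (.ofAdd lam), fun _ => norm_exp_I_mul _ _,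
    fun x y => by simp only [ofAdd_add, map_mul]⟩

/-- Kronecker's theorem in the topology of pointwise convergence; the approximating net is indexed
by a finite set of frequencies and a precision. -/
theorem denseRange_contChar : DenseRange contChar := by
  intro χ
  have h : ∀ p : Finset ℝ × ℕ, ∃ t : ℝ, ∀ lam ∈ p.1,
      ‖expChar t (.ofAdd lam) - charHom χ (.ofAdd lam)‖ < 1 / ((p.2 : ℝ) + 1) := fun p =>
    exists_norm_expChar_sub_lt (charHom χ) (fun x => χ.2.1 x.toAdd) p.1 (by positivity)
  choose t ht using h
  refine mem_closure_of_tendsto (b := atTop) (f := fun p => contChar (t p)) ?_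
    (Eventually.of_forall fun p => ⟨t p, rfl⟩)
  rw [tendsto_subtype_rng, tendsto_pi_nhds]
  intro lam
  rw [tendsto_iff_norm_sub_tendsto_zero]
  have h2 : Tendsto (fun p : Finset ℝ × ℕ => 1 / ((p.2 : ℝ) + 1)) atTop (𝓝 0) := by
    rw [← prod_atTop_atTop_eq]
    exact tendsto_one_div_add_atTop_nhds_zero_nat.comp tendsto_snd
  refine squeeze_zero' (Eventually.of_forall fun _ => norm_nonneg _) ?_ h2
  filter_upwards [eventually_ge_atTop (({lam}, 0) : Finset ℝ × ℕ)] with p hp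
  exact (ht p lam (Finset.singleton_subset_iff.1 hp.1)).le

/-! ### The action of the characters -/

/-- The pointwise product of a character and a square summable family. -/
def twist (a : CoeffSpace) (χ : charSet) : CoeffSpace :=
  ⟨fun lam => χ.1 lam * a lam, (lp.memℓp a).mono' fun lam => by
    rw [norm_mul, χ.2.1, one_mul]⟩

theorem twist_apply (a : CoeffSpace) (χ : charSet) (lam : ℝ) :
    twist a χ lam = χ.1 lam * a lam := rfl

theorem norm_twist_apply (a : CoeffSpace) (χ : charSet) (lam : ℝ) :
    ‖twist a χ lam‖ = ‖a lam‖ := by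
  rw [twist_apply, norm_mul, χ.2.1, one_mul]

theorem norm_twist (a : CoeffSpace) (χ : charSet) : ‖twist a χ‖ = ‖a‖ := by
  rw [lp.norm_eq_tsum_rpow (by simp), lp.norm_eq_tsum_rpow (by simp)]
  simp only [norm_twist_apply]

/-- Since `|χ| = 1`, the tails of `twist a χ` have the same norms as those of `a`. The finite
partial sums, each depending on finitely many values of `χ`, thus converge uniformly in `χ`. -/
theorem continuous_twist (a : CoeffSpace) : Continuous (twist a) := by
  let F : Finset ℝ → charSet → CoeffSpace := fun s χ => ∑ lam ∈ s, lp.single 2 lam (twist a χ lam)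
  have hF : TendstoUniformly F (twist a) atTop := by
    rw [Metric.tendstoUniformly_iff]
    intro ε hε
    filter_upwards [Metric.tendsto_nhds.1 (lp.hasSum_single (by simp) a) ε hε] with s hs χ
    refine lt_of_eq_of_lt ?_ hs
    rw [dist_comm _ a, dist_eq_norm, dist_eq_norm]
    have h1 := lp.norm_compl_sum_single (p := 2) (by simp) (twist a χ) s
    have h2 := lp.norm_compl_sum_single (p := 2) (by simp) a s
    simp only [norm_twist, norm_twist_apply] at h1
    rw [← h2] at h1
    exact (Real.rpow_left_inj (norm_nonneg _) (norm_nonneg _) (by simp)).1 h1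
  refine hF.continuous (Frequently.of_forall fun s => continuous_finsetSum _ fun lam _ => ?_)
  refine (lp.isometry_single lam).continuous.comp ?_
  exact ((continuous_apply lam).comp continuous_subtype_val).mul continuous_const

/-- The action of a character on the Fourier series of an element of `B²(ℝ, ℂ)`. -/
def charAct (f : B2) (χ : charSet) : B2 := fourierEquiv.symm (twist (fourierEquiv f) χ)

theorem continuous_charAct (f : B2) : Continuous (charAct f) :=
  fourierEquiv.symm.continuous.comp (continuous_twist _)

theorem charAct_eq_iff (f g : B2) (χ : charSet) :
    charAct f χ = g ↔ ∀ lam, g.fourierCoeff lam = χ.1 lam * f.fourierCoeff lam := by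
  simp only [fourierCoeff_eq]
  rw [charAct, LinearIsometryEquiv.symm_apply_eq, lp.ext_iff, funext_iff]
  simp only [twist_apply, eq_comm]

theorem charAct_contChar (f : B2) (τ : ℝ) : charAct f (contChar τ) = B2.translate τ f := by
  rw [charAct_eq_iff]
  intro lam
  rw [fourierCoeff_eq, fourierCoeff_eq, fourierEquiv_translate]
  rfl

/-- By compactness the orbit map is closed, so it carries the closure of the dense set of
exponentials onto the closure of the translates. -/
theorem closure_translates (f : B2) : closure f.translates = Set.range (charAct f) := by
  have h : f.translates = charAct f '' Set.range contChar := by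
    rw [← Set.range_comp]
    exact congrArg Set.range (funext fun τ => (charAct_contChar f τ).symm)
  rw [h, (continuous_charAct f).isClosedMap.closure_image_eq_of_continuous (continuous_charAct f),
    denseRange_contChar.closure_range, Set.image_univ]

theorem isCompact_closure_translates (f : B2) : IsCompact (closure f.translates) := by
  rw [closure_translates]
  exact isCompact_range (continuous_charAct f)

/-! ### Bohr equivalence -/

theorem exp_mem_charSet (ψ : ℝ →ₗ[ℚ] ℝ) :
    (fun x : ℝ => Complex.exp (Complex.I * (ψ x : ℝ))) ∈ charSet := by
  refine ⟨fun x => ?_, fun x y => ?_⟩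
  · simp only [mul_comm Complex.I, Complex.norm_exp_ofReal_mul_I]
  · simp only [map_add, Complex.ofReal_add, mul_add, Complex.exp_add]

/-- On finitely many real numbers a character of `ℝ` is the exponential of a `ℚ`-linear map. -/
theorem exists_linearMap_exp_eq {χ : ℝ → ℂ} (hχ : χ ∈ charSet) {S : Set ℝ} (hS : S.Finite) :
    ∃ ψ : ℝ →ₗ[ℚ] ℝ, ∀ x ∈ S, Complex.exp (Complex.I * (ψ x : ℝ)) = χ x := by
  -- A finitely generated subgroup of `ℝ` is free. A `ℤ`-basis stays independent over `ℚ`, so `ψ`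
  -- may be prescribed on it as the argument of `χ`.
  let G : Submodule ℤ ℝ := Submodule.span ℤ S
  have : Module.Finite ℤ G := Module.Finite.span_of_finite ℤ hS
  let b := Module.Free.chooseBasis ℤ G
  have hli : LinearIndependent ℤ fun i => (b i : ℝ) :=
    b.linearIndependent.map' G.subtype G.ker_subtype
  have hli' : LinearIndependent ℚ fun i => (b i : ℝ) :=
    (LinearIndependent.iff_fractionRing ℤ ℚ).1 hli
  have harg : ∀ x : ℝ, Complex.exp (Complex.I * (Complex.arg (χ x) : ℝ)) = χ x := fun x => by
    have := Complex.norm_mul_exp_arg_mul_I (χ x)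
    rwa [hχ.1, Complex.ofReal_one, one_mul, mul_comm] at this
  obtain ⟨ψ, hψ⟩ := LinearMap.exists_extend
    ((Module.Basis.span hli').constr ℚ fun i => Complex.arg (χ (b i)))
  have hψb : ∀ i, ψ (b i) = Complex.arg (χ (b i)) := fun i => by
    have h := LinearMap.congr_fun hψ (Module.Basis.span hli' i)
    rw [Module.Basis.constr_basis, LinearMap.comp_apply, Submodule.subtype_apply,
      Module.Basis.span_apply] at h
    exact h
  have hE := exp_mem_charSet ψ
  -- The two characters agree on a subgroup; it contains the basis, hence all of `G`.
  let H : AddSubgroup ℝ :=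
    { carrier := {x | Complex.exp (Complex.I * (ψ x : ℝ)) = χ x}
      zero_mem' := by
        simp [map_zero_of_mem_charSet hχ]
      add_mem' := fun {x y} hx hy => by
        have := hE.2 x y
        simp only [Set.mem_ofPred_eq] at hx hy this ⊢
        rw [this, hx, hy, hχ.2]
      neg_mem' := fun {x} hx => by
        have h1 := hE.2 (-x) x
        have h2 := hχ.2 (-x) x
        simp only [Set.mem_ofPred_eq] at hx ⊢
        rw [neg_add_cancel] at h1 h2
        have h0 : χ x ≠ 0 := norm_ne_zero_iff.1 (by rw [hχ.1]; norm_num)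
        refine mul_right_cancel₀ h0 ?_
        rw [← h2, map_zero_of_mem_charSet hχ, ← hx, ← map_zero_of_mem_charSet hE]
        exact h1.symm }
  have hH : (⊤ : Submodule ℤ G) ≤ (AddSubgroup.toIntSubmodule H).comap G.subtype := by
    rw [← b.span_eq, Submodule.span_le]
    rintro _ ⟨i, rfl⟩
    change Complex.exp (Complex.I * (ψ (b i) : ℝ)) = χ (b i)
    rw [hψb, harg]
  exact ⟨ψ, fun x hx => hH (x := ⟨x, Submodule.subset_span hx⟩) trivial⟩

theorem charAct_mem_bohrClass {Λ : Exponents} {f : B2} (hf : f ∈ classF Λ) (χ : charSet) :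
    charAct f χ ∈ bohrClass Λ f := by
  have h := (charAct_eq_iff f _ χ).1 rfl
  refine ⟨fun lam hlam => by rw [h, hf lam hlam, mul_zero], fun n _ => ?_⟩
  obtain ⟨ψ, hψ⟩ := exists_linearMap_exp_eq χ.2 ((Set.finite_lt_nat n).image Λ.freq)
  refine ⟨ψ.domRestrict (Λ.V n), fun j hj => ?_⟩
  rw [h, mul_comm, LinearMap.domRestrict_apply]
  exact congrArg _ (hψ _ ⟨j, hj, rfl⟩).symm

/-- The maps `ψₙ` for different `n` need not be compatible. The characters realizing the first `n`
relations nevertheless form decreasing nonempty compact sets, and any common point works. -/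
theorem exists_charAct_eq {Λ : Exponents} {f g : B2} (hf : f ∈ classF Λ)
    (hg : g ∈ bohrClass Λ f) : ∃ χ, charAct f χ = g := by
  let C : ℕ → Set (ℝ → ℂ) := fun n => charSet ∩ {χ | ∀ j : ℕ, j < n → (j : ℕ∞) < Λ.size →
    g.fourierCoeff (Λ.freq j) = χ (Λ.freq j) * f.fourierCoeff (Λ.freq j)}
  have hcl : ∀ n, IsClosed (C n) := fun n => by
    refine isClosed_charSet.inter ?_
    simp only [Set.ofPred_forall]
    refine isClosed_iInter fun j => isClosed_iInter fun _ => isClosed_iInter fun _ => ?_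
    exact isClosed_eq (by fun_prop) (by fun_prop)
  have hne : ∀ n, (C n).Nonempty := fun n => by
    -- `m = min n #Λ`, since equivalence supplies `ψ` only up to the size of `Λ`.
    obtain ⟨m, hm⟩ := ENat.ne_top_iff_exists.1
      (ne_top_of_le_ne_top (ENat.natCast_ne_top n) (min_le_left (n : ℕ∞) Λ.size))
    obtain ⟨ψ, hψ⟩ := hg.2 m (hm.trans_le (min_le_right _ _))
    obtain ⟨ψ', hψ'⟩ := LinearMap.exists_extend ψ
    refine ⟨_, exp_mem_charSet ψ', fun j hj hj' => ?_⟩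
    have hjm : j < m := by
      have : (j : ℕ∞) < m := by
        rw [hm]
        exact lt_min (by exact_mod_cast hj) hj'
      exact_mod_cast this
    rw [hψ j hjm, mul_comm, ← hψ']
    rfl
  obtain ⟨χ, hχ⟩ := IsCompact.nonempty_iInter_of_sequence_nonempty_isCompact_isClosed C
    (fun n => Set.inter_subset_inter_right _ fun χ h j hj => h j (hj.trans (Nat.lt_succ_self n)))
    hne (isCompact_charSet.of_isClosed_subset (hcl 0) Set.inter_subset_left) hcl
  rw [Set.mem_iInter] at hχ
  refine ⟨⟨χ, (hχ 0).1⟩, (charAct_eq_iff _ _ _).2 fun lam => ?_⟩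
  by_cases hlam : lam ∈ Λ.toSet
  · obtain ⟨j, hj, rfl⟩ := hlam
    exact (hχ (j + 1)).2 j (Nat.lt_succ_self j) hj
  · rw [hg.1 lam hlam, hf lam hlam, mul_zero]

theorem closure_translates_eq_bohrClass {Λ : Exponents} {f : B2} (hf : f ∈ classF Λ) :
    closure f.translates = bohrClass Λ f := by
  rw [closure_translates]
  refine Set.Subset.antisymm ?_ fun g hg => exists_charAct_eq hf hg
  rintro _ ⟨χ, rfl⟩
  exact charAct_mem_bohrClass hf χ

/-! ### Existence of an enumerated set of exponents -/

theorem countable_support_fourierCoeff (f : B2) : (Function.support f.fourierCoeff).Countable := by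
  have h := ((lp.memℓp (fourierEquiv f)).summable (by simp)).countable_support
  refine h.mono fun lam hlam => ?_
  rw [Function.mem_support, fourierCoeff_eq] at hlam
  simpa using hlam

/-- Every countable set of real numbers is contained in an enumerated one. -/
theorem exists_exponents_superset {S : Set ℝ} (hS : S.Countable) :
    ∃ Λ : Exponents, S ⊆ Λ.toSet := by
  -- Adjoining the natural numbers makes the set infinite, so it is enumerated bijectively by `ℕ`
  -- with size `⊤`. Enlarging is harmless, as only a superset is needed.
  let T : Set ℝ := S ∪ Set.range (Nat.cast : ℕ → ℝ)
  have : Countable T := (hS.union (Set.countable_range _)).to_subtype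
  have : Infinite T :=
    ((Set.infinite_range_of_injective Nat.cast_injective).mono Set.subset_union_right).to_subtype
  obtain ⟨_⟩ := nonempty_denumerable T
  let e := (Denumerable.eqv T).symm
  refine ⟨⟨⊤, fun n => e n, (Subtype.val_injective.comp e.injective).injOn⟩, fun x hx => ?_⟩
  refine ⟨e.symm ⟨x, Or.inl hx⟩, ENat.natCast_lt_top _, ?_⟩
  simp

end Besicovitch2

end

theorem mainTheorem3 (f : Besicovitch2.B2) :
    IsCompact (closure f.translates) ∧
    (∃ Λ : Besicovitch2.Exponents, f ∈ Besicovitch2.classF Λ) ∧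
    ∀ Λ : Besicovitch2.Exponents, f ∈ Besicovitch2.classF Λ →
      closure f.translates = Besicovitch2.bohrClass Λ f ∧
      ∀ τ : ℕ → ℝ, ∃ g ∈ Besicovitch2.bohrClass Λ f, ∃ φ : ℕ → ℕ, StrictMono φ ∧
        Filter.Tendsto (fun n => Besicovitch2.B2.translate (τ (φ n)) f) Filter.atTop (nhds g) := by
  refine ⟨Besicovitch2.isCompact_closure_translates f, ?_, fun Λ hf => ?_⟩
  · obtain ⟨Λ, hΛ⟩ :=
      Besicovitch2.exists_exponents_superset (Besicovitch2.countable_support_fourierCoeff f)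
    exact ⟨Λ, fun lam hlam => Function.notMem_support.1 fun h => hlam (hΛ h)⟩
  · have h := Besicovitch2.closure_translates_eq_bohrClass hf
    refine ⟨h, fun τ => ?_⟩
    rw [← h]
    exact (Besicovitch2.isCompact_closure_translates f).tendsto_subseq
      fun n => subset_closure ⟨τ n, rfl⟩
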